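/- Let $\Sigma$ be a finite alphabet with at least two letters, let $\$\notin\Sigma$, put $\Sigma_\$ := \Sigma\cup\{\$\}$, and let $\mathrm{Prop}$ be a set of propositions. For a class $\mathfrak L$ of languages over $\Sigma_\$$, the formulas of test-free propositional dynamic logic $\mathrm{PDL}_{\mathrm{plain}}[\mathfrak L]$ are given by $$\varphi ::= \mathtt{False} \mid \mathtt{True} \mid p \mid \neg p \mid \varphi\vee\varphi \mid \varphi\wedge\varphi \mid \mathsf{EF}^L\varphi \mid \mathsf{AG}^L\varphi \qquad (p\in\mathrm{Prop},\ L\in\mathfrak L).$$ Formulas are interpreted at the states of labeled transition systems with edge labels in $\Sigma_\$$ and with a set of propositions attached to each state: constants, literals and Boolean connectives have their usual meaning, and $\mathsf{EF}^L\varphi$ (respectively $\mathsf{AG}^L\varphi$) holds at a state $s$ iff for some (respectively every) finite path that starts in $s$ and whose label sequence is a word of $L$, the formula $\varphi$ holds at the last state of the path. Two formulas are equivalent iff they hold at the same states of all labeled transition systems. Let $\mathrm{DCFL}$ be the class of languages over $\Sigma_\$$ accepted by final state by deterministic pushdown automata, and let $\mathrm{CFL}$ be the class of context-free languages over $\Sigma_\$$.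 Then $\mathrm{PDL}_{\mathrm{plain}}[\mathrm{DCFL}]$ is strictly less expressive than $\mathrm{PDL}_{\mathrm{plain}}[\mathrm{CFL}]$: every $\mathrm{PDL}_{\mathrm{plain}}[\mathrm{DCFL}]$-formula is equivalent to a $\mathrm{PDL}_{\mathrm{plain}}[\mathrm{CFL}]$-formula, but not conversely. Concretely, let $\mathrm{Pal} := \{w\in\Sigma^* \mid w = w^R\}$ be the set of palindromes, where $w^R$ is the reversal of $w$, and let $\mathrm{Pal}\,\$ := \{w\$ \mid w\in\mathrm{Pal}\}$. Then $\mathsf{EF}^{\mathrm{Pal}\,\$}\,\mathtt{True}$ is a $\mathrm{PDL}_{\mathrm{plain}}[\mathrm{CFL}]$-formula, and no $\mathrm{PDL}_{\mathrm{plain}}[\mathrm{DCFL}]$-formula is equivalent to it. -/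

import Mathlib

universe u v w

/-- A deterministic pushdown automaton over the input alphabet `A`, with finitely many states and
finitely many stack symbols.  `read q a X` is the move (if any) that consumes the letter `a` in
state `q` with topmost stack symbol `X`, and `eps q X` is the move (if any) that consumes no input.
A move replaces the topmost stack symbol by a word (leftmost symbol on top) and changes the state.
Determinism: each of these moves is unique, and a spontaneous move excludes all reading moves. -/
structure DPDA (A : Type u) where
  State : Type
  StackSymbol : Type
  finite_state : Finite State
  finite_stackSymbol : Finite StackSymbol
  start : State
  bottom : StackSymbol
  final : Set State
  read : State → A → StackSymbol → Option (State × List StackSymbol)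
  eps : State → StackSymbol → Option (State × List StackSymbol)
  deterministic : ∀ q X, eps q X ≠ none → ∀ a, read q a X = none

namespace DPDA

variable {A : Type u}

/-- A configuration: current state, remaining input, stack (topmost symbol first). -/
abbrev Config (M : DPDA A) : Type u := M.State × List A × List M.StackSymbol

/-- One move of the automaton. -/
inductive Step (M : DPDA A) : M.Config → M.Config → Prop
  | read {q q' : M.State} {a : A} {X : M.StackSymbol} {γ : List M.StackSymbol}
      (x : List A) (β : List M.StackSymbol) (h : M.read q a X = some (q', γ)) :
      Step M (q, a :: x, X :: β) (q', x, γ ++ β)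
  | eps {q q' : M.State} {X : M.StackSymbol} {γ : List M.StackSymbol}
      (x : List A) (β : List M.StackSymbol) (h : M.eps q X = some (q', γ)) :
      Step M (q, x, X :: β) (q', x, γ ++ β)

/-- The language accepted by final state: some run from the initial configuration consumes the
whole input and reaches a final state. -/
def language (M : DPDA A) : Language A :=
  {x | ∃ q ∈ M.final, ∃ β : List M.StackSymbol,
    Relation.ReflTransGen M.Step (M.start, x, [M.bottom]) (q, [], β)}

end DPDA

/-- The class of deterministic context-free languages over `A`. -/
def DCFL (A : Type u) : Set (Language A) := {L | ∃ M : DPDA A, M.language = L}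

/-- The class of context-free languages over `A`. -/
def CFL (A : Type u) : Set (Language A) := {L | L.IsContextFree}

/-- Labeled transition systems with edge labels in `A` and propositions in `P`. -/
structure LTS (A : Type u) (P : Type v) where
  State : Type w
  Trans : State → A → State → Prop
  val : State → Set P

/-- `T.Path s x t`: there is a path from `s` to `t` in `T` which is labeled with the word `x`. -/
inductive LTS.Path {A : Type u} {P : Type v} (T : LTS.{u, v, w} A P) :
    T.State → List A → T.State → Prop
  | nil (s : T.State) : Path T s [] s
  | cons {s s' t : T.State} {a : A} {x : List A} (h : T.Trans s a s') (p : Path T s' x t) :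
      Path T s (a :: x) t

/-- Test-free formulas in negation normal form; programs are arbitrary languages over `A`.
`EF L φ` is the diamond `⟨L⟩φ` and `AG L φ` is the box `[L]φ`. -/
inductive PDLFormula (A : Type u) (P : Type v) : Type (max u v)
  | fls : PDLFormula A P
  | tru : PDLFormula A P
  | prop (p : P) : PDLFormula A P
  | negProp (p : P) : PDLFormula A P
  | or (φ ψ : PDLFormula A P) : PDLFormula A P
  | and (φ ψ : PDLFormula A P) : PDLFormula A P
  | EF (L : Language A) (φ : PDLFormula A P) : PDLFormula A P
  | AG (L : Language A) (φ : PDLFormula A P) : PDLFormula A P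

namespace PDLFormula

variable {A : Type u} {P : Type v}

/-- `φ.Sat T s`: the formula `φ` holds in the structure `(T, s)`. -/
def Sat (T : LTS.{u, v, w} A P) : PDLFormula A P → T.State → Prop
  | fls, _ => False
  | tru, _ => True
  | prop p, s => p ∈ T.val s
  | negProp p, s => p ∉ T.val s
  | or φ ψ, s => Sat T φ s ∨ Sat T ψ s
  | and φ ψ, s => Sat T φ s ∧ Sat T ψ s
  | EF L φ, s => ∃ x ∈ L, ∃ t, T.Path s x t ∧ Sat T φ t
  | AG L φ, s => ∀ x ∈ L, ∀ t, T.Path s x t → Sat T φ t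

/-- Equivalence: the same structures (with state space in `Type w`) are models. -/
def Equivalent (φ ψ : PDLFormula A P) : Prop :=
  ∀ (T : LTS.{u, v, w} A P) (s : T.State), Sat T φ s ↔ Sat T ψ s

/-- All programs that occur in the formula belong to the class `C` of languages. -/
def ProgramsIn (C : Set (Language A)) : PDLFormula A P → Prop
  | fls => True
  | tru => True
  | prop _ => True
  | negProp _ => True
  | or φ ψ => ProgramsIn C φ ∧ ProgramsIn C ψ
  | and φ ψ => ProgramsIn C φ ∧ ProgramsIn C ψ
  | EF L φ => L ∈ C ∧ ProgramsIn C φ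
  | AG L φ => L ∈ C ∧ ProgramsIn C φ

end PDLFormula

/-- The logic `PDL_plain[C]` over edge labels `A` and propositions `P`, as a set of formulas. -/
def PDLplain {A : Type u} (C : Set (Language A)) (P : Type v) : Set (PDLFormula A P) :=
  {φ | φ.ProgramsIn C}

/-- Every formula of `F` is equivalent to a formula of `G`. -/
def AtMostAsExpressive {A : Type u} {P : Type v} (F G : Set (PDLFormula A P)) : Prop :=
  ∀ φ ∈ F, ∃ ψ ∈ G, PDLFormula.Equivalent.{u, v, w} φ ψ

/-- `F` is strictly less expressive than `G`. -/
def StrictlyLessExpressive {A : Type u} {P : Type v} (F G : Set (PDLFormula A P)) : Prop :=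
  AtMostAsExpressive.{u, v, w} F G ∧ ¬ AtMostAsExpressive.{u, v, w} G F

/-- The palindromes over `A`. -/
def palindromes (A : Type u) : Language A := {x | x.reverse = x}

/-- The language of words `x$` with `x` a palindrome over `A`.  The alphabet `A` extended by the
fresh letter `$` is `Option A`, where `$` is `none`. -/
def palindromesDollar (A : Type u) : Language (Option A) :=
  {y | ∃ x ∈ palindromes A, y = x.map some ++ [none]}

/-- The formula `EF^{Pal $} True`. -/
def palFormula (A : Type u) (P : Type v) : PDLFormula (Option A) P :=
  PDLFormula.EF (palindromesDollar A) PDLFormula.tru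

/-!
The inclusion holds because deterministic context-free languages are context-free, by the triple
construction (`DPDA.language_grammar`), and `palFormula` is a formula over context-free languages by
the usual grammar for palindromes (`language_palindromeGrammar`).

That `palFormula` is not equivalent to a formula over deterministic context-free languages rests on
a weakness of deterministic pushdown automata that has nothing to do with palindromes: they cannot
remember everything they have read.  Every word `x` has an extension with a *collision* in the
language `L`, a different word of the same length that has at least the same continuations in `L`
(`exists_hasCollision`).  To see this, extend words such that the stack below the topmost symbol is
not exposed again before the end marker.  The configurations reached then have finitely many types,
each of which determines the continuations (`DPDA.append_mem_language_of_hasType`).  Some type is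
recurrent: it can be reached again after every further extension.  From there, two words `y` and
`y'` with different first letters return to the same type, so `y ++ y'` and `y' ++ y` collide.

For a word `u` over `A` consider the transition system `LTS.separating P u` with states `(k, b)`,
where `k` is a layer and `b` a flag.  From `(0, true)` every word of the length of `u` leads to the
flag `true`, from `(0, false)` every such word except `u` does, and after that exactly the reversal
of `u` followed by the end marker can be read.  So `(0, true)` satisfies `palFormula` because of the
palindrome `u ++ u.reverse`, while `(0, false)` does not.  A formula `EF L φ` or `AG L φ` can
distinguish `(k, true)` from `(k, false)` only by a word of `L` that follows `u` from position `k`.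
If the word is long, a collision replaces it by a word that deviates from `u` and leads to the same
state from both.  If it is short, the states reached lie in one of the first layers, and `φ` does
not distinguish them.  Thus for a given formula a word `u` can be built by structural recursion,
collisions for a program first and the requirements of the subformula second, such that the formula
does not distinguish `(0, true)` from `(0, false)` (`PDLFormula.exists_forall_sat_iff`).
-/

/-! ### Runs of deterministic pushdown automata -/

namespace DPDA

variable {A : Type u} {M : DPDA A}

/-- Finitely many moves of the automaton. -/
abbrev Runs (M : DPDA A) : M.Config → M.Config → Prop := Relation.ReflTransGen M.Step

theorem Step.append {c d : M.Config} (h : M.Step c d) (y : List A) (β : List M.StackSymbol) :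
    M.Step (c.1, c.2.1 ++ y, c.2.2 ++ β) (d.1, d.2.1 ++ y, d.2.2 ++ β) := by
  cases h with
  | read x β' h => simpa using Step.read (x ++ y) (β' ++ β) h
  | eps x β' h => simpa using Step.eps (x ++ y) (β' ++ β) h

/-- Unread input and a deeper part of the stack may be added to a run. -/
theorem Runs.append {q q' : M.State} {x x' : List A} {γ γ' : List M.StackSymbol}
    (h : M.Runs (q, x, γ) (q', x', γ')) (y : List A) (β : List M.StackSymbol) :
    M.Runs (q, x ++ y, γ ++ β) (q', x' ++ y, γ' ++ β) :=
  Relation.ReflTransGen.lift (fun c : M.Config => ((c.1, c.2.1 ++ y, c.2.2 ++ β) : M.Config))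
    (fun _ _ h => h.append y β) _ _ h

theorem Step.rightUnique : Relator.RightUnique M.Step := by
  intro c d d' h h'
  cases h with
  | read x β h =>
    cases h' with
    | read _ _ h' =>
      rw [h] at h'
      cases h'
      rfl
    | eps _ _ h' =>
      rw [M.deterministic _ _ (by rw [h']; exact Option.some_ne_none _)] at h
      cases h
  | eps x β h =>
    cases h' with
    | read _ _ h' =>
      rw [M.deterministic _ _ (by rw [h]; exact Option.some_ne_none _)] at h'
      cases h'
    | eps _ _ h' =>
      rw [h] at h'
      cases h'
      rfl

/-- Input that remains unread at the end of a run may be removed from the whole run. -/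
theorem Runs.exists_prefix {c d : M.Config} (h : M.Runs c d) {y z : List A}
    (hd : d.2.1 = z ++ y) : ∃ x, c.2.1 = x ++ y ∧ M.Runs (c.1, x, c.2.2) (d.1, z, d.2.2) := by
  induction h using Relation.ReflTransGen.head_induction_on with
  | refl => exact ⟨z, hd, .refl⟩
  | head h _ ih =>
    obtain ⟨x, hx, hr⟩ := ih
    cases h with
    | @read _ _ a _ _ x' β h =>
      obtain rfl : x' = x ++ y := hx
      exact ⟨a :: x, rfl, .head (.read x β h) hr⟩
    | eps x' β h =>
      obtain rfl : x' = x ++ y := hx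
      exact ⟨x, rfl, .head (.eps x β h) hr⟩

/-- A run on `x ++ y` passes through a configuration in which exactly `x` has been read. -/
theorem Runs.split {c d : M.Config} (h : M.Runs c d) (hd : d.2.1 = []) {x y : List A}
    (hc : c.2.1 = x ++ y) :
    ∃ q β, M.Runs (c.1, x, c.2.2) (q, [], β) ∧ M.Runs (q, y, β) d := by
  induction h using Relation.ReflTransGen.head_induction_on generalizing x with
  | refl =>
    obtain ⟨rfl, rfl⟩ := List.append_eq_nil_iff.1 (hc.symm.trans hd)
    refine ⟨d.1, d.2.2, .refl, ?_⟩
    rw [← hd]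
  | @head c c' h h' ih =>
    cases x with
    | nil =>
      refine ⟨c.1, c.2.2, .refl, ?_⟩
      obtain rfl : c.2.1 = y := hc
      exact .head h h'
    | cons a x =>
      cases h with
      | read x' β h =>
        obtain ⟨rfl, rfl⟩ := List.cons_eq_cons.1 hc
        obtain ⟨q, δ, h1, h2⟩ := ih rfl
        exact ⟨q, δ, .head (.read x β h) h1, h2⟩
      | eps x' β h =>
        obtain rfl : x' = a :: x ++ y := hc
        obtain ⟨q, δ, h1, h2⟩ := ih rfl
        exact ⟨q, δ, .head (.eps _ β h) h1, h2⟩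

/-- A run that starts with the stack `γ ++ β` either never touches `β`, or it contains a moment at
which `γ` has just been removed. -/
theorem Runs.untouched_or_popped {q : M.State} {x : List A} {γ β : List M.StackSymbol}
    {d : M.Config} (h : M.Runs (q, x, γ ++ β) d) :
    (∃ δ, d.2.2 = δ ++ β ∧ M.Runs (q, x, γ) (d.1, d.2.1, δ)) ∨
      ∃ p y, M.Runs (q, x, γ) (p, y, []) ∧ M.Runs (p, y, β) d := by
  generalize hc : ((q, x, γ ++ β) : M.Config) = c at h
  induction h using Relation.ReflTransGen.head_induction_on generalizing q x γ with
  | refl =>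
    subst hc
    exact .inl ⟨γ, rfl, .refl⟩
  | head h h' ih =>
    subst hc
    cases γ with
    | nil => exact .inr ⟨q, x, .refl, .head h h'⟩
    | cons X γ =>
      generalize hc : ((q, x, X :: γ ++ β) : M.Config) = c at h
      cases h with
      | read x β' h =>
        cases hc
        have key := Step.read x γ h
        rcases ih (congrArg (fun δ => (_, _, δ)) (List.append_assoc _ γ β)) with
          ⟨δ, hδ, hr⟩ | ⟨p, y, h1, h2⟩
        · exact .inl ⟨δ, hδ, .head key hr⟩
        · exact .inr ⟨p, y, .head key h1, h2⟩
      | eps x β' h =>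
        cases hc
        have key := Step.eps x γ h
        rcases ih (congrArg (fun δ => (_, _, δ)) (List.append_assoc _ γ β)) with
          ⟨δ, hδ, hr⟩ | ⟨p, y, h1, h2⟩
        · exact .inl ⟨δ, hδ, .head key hr⟩
        · exact .inr ⟨p, y, .head key h1, h2⟩

end DPDA

/-! ### Languages of context-free grammars -/

namespace ContextFreeGrammar

variable {T : Type u}

/-- The language denoted by a string of symbols, once every nonterminal denotes a language. -/
def denotation {N : Type} (I : N → Language T) (s : List (Symbol T N)) : Language T :=
  (s.map fun | .terminal a => ({[a]} : Language T) | .nonterminal n => I n).prod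

variable {N : Type} {I : N → Language T}

@[simp]
theorem denotation_nil : denotation I [] = 1 := rfl

@[simp]
theorem denotation_append (s t : List (Symbol T N)) :
    denotation I (s ++ t) = denotation I s * denotation I t := by
  simp [denotation]

theorem denotation_terminal (a : T) (s : List (Symbol T N)) :
    denotation I (.terminal a :: s) = ({[a]} : Language T) * denotation I s := rfl

theorem denotation_nonterminal (n : N) (s : List (Symbol T N)) :
    denotation I (.nonterminal n :: s) = I n * denotation I s := rfl

theorem mem_denotation_map_terminal (x : List T) : x ∈ denotation I (x.map .terminal) := by
  induction x with
  | nil => exact Language.nil_mem_one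
  | cons a x ih =>
    rw [List.map_cons, denotation_terminal]
    exact Language.mem_mul.2 ⟨[a], rfl, x, ih, rfl⟩

/-- An assignment of languages to the nonterminals that is closed under the rules is an upper bound
for the words that can be derived. -/
theorem mem_of_derives {g : ContextFreeGrammar T} (I : g.NT → Language T)
    (hI : ∀ r ∈ g.rules, denotation I r.output ≤ I r.input) {s : List (Symbol T g.NT)} {x : List T}
    (h : g.Derives s (x.map .terminal)) : x ∈ denotation I s := by
  induction h using Relation.ReflTransGen.head_induction_on with
  | refl => exact mem_denotation_map_terminal x
  | head h _ ih =>
    obtain ⟨r, hr, h⟩ := h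
    obtain ⟨p, q, rfl, rfl⟩ := h.exists_parts
    have key : denotation I (p ++ r.output ++ q) ≤
        denotation I (p ++ [.nonterminal r.input] ++ q) := by
      simp only [denotation_append, denotation_nonterminal, denotation_nil, mul_one]
      gcongr
      exact hI r hr
    exact key ih

theorem derives_of_mem_rules {g : ContextFreeGrammar T} {r : ContextFreeRule T g.NT}
    (hr : r ∈ g.rules) : g.Derives [.nonterminal r.input] r.output :=
  .single ⟨r, hr, .input_output⟩

end ContextFreeGrammar

/-! ### Deterministic context-free languages are context-free -/

namespace DPDA

variable {A : Type u} (M : DPDA A)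

/-- What a run is asked to end with: the goal `some p` is the state `p` with empty stack, and
`none` is a final state with any stack. -/
def Goal : Option M.State → M.State → List M.StackSymbol → Prop
  | some p, q, β => q = p ∧ β = []
  | none, q, _ => q ∈ M.final

/-- The words that lead from state `q` and stack `γ` to the goal `o`. -/
def wordsTo (o : Option M.State) (q : M.State) (γ : List M.StackSymbol) : Language A :=
  {x | ∃ q' β, M.Goal o q' β ∧ M.Runs (q, x, γ) (q', [], β)}

/-- Nonterminals of the grammar of an automaton: `some (q, X, o)` stands for the words that lead
from state `q` and stack `X` to the goal `o`, and `none` is the initial nonterminal. -/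
abbrev Nonterminal : Type := Option (M.State × M.StackSymbol × Option M.State)

/-- The strings of nonterminals that describe how the goal `o` may be reached from state `q` and
stack `γ`: the symbols of `γ` are removed one by one and the states in between are guessed; for
the goal `none` the final state may be reached before a symbol is removed. -/
def expansions (o : Option M.State) :
    M.State → List M.StackSymbol → Set (List (Symbol A M.Nonterminal))
  | q, [] => {s | s = [] ∧ M.Goal o q []}
  | q, Y :: γ =>
    {s | o = none ∧ s = [.nonterminal (some (q, Y, none))]} ∪
      ⋃ p, (fun s => .nonterminal (some (q, Y, some p)) :: s) '' expansions o p γ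

/-- The rules of the grammar of an automaton. -/
inductive IsRule : ContextFreeRule A M.Nonterminal → Prop
  | start {s} (h : s ∈ M.expansions none M.start [M.bottom]) : IsRule ⟨none, s⟩
  | final {q} (X) (h : q ∈ M.final) : IsRule ⟨some (q, X, none), []⟩
  | read {q a X q' γ o s} (h : M.read q a X = some (q', γ)) (hs : s ∈ M.expansions o q' γ) :
      IsRule ⟨some (q, X, o), .terminal a :: s⟩
  | eps {q X q' γ o s} (h : M.eps q X = some (q', γ)) (hs : s ∈ M.expansions o q' γ) :
      IsRule ⟨some (q, X, o), s⟩

theorem finite_expansions (o : Option M.State) (q : M.State) (γ : List M.StackSymbol) :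
    (M.expansions o q γ).Finite := by
  have := M.finite_state
  induction γ generalizing q with
  | nil => exact (Set.finite_singleton []).subset fun s hs => hs.1
  | cons Y γ ih =>
    refine .union ((Set.finite_singleton _).subset fun s hs => hs.2) ?_
    exact Set.finite_iUnion fun p => (ih p).image _

theorem finite_setOf_isRule [Finite A] : {r | M.IsRule r}.Finite := by
  have := M.finite_state
  have := M.finite_stackSymbol
  have hsome {α : Type} (c : Option α) : {d | c = some d}.Finite :=
    Set.Subsingleton.finite fun d hd e he => Option.some_injective _ (hd.symm.trans he)
  have h1 := (M.finite_expansions none M.start [M.bottom]).image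
    fun s => (⟨none, s⟩ : ContextFreeRule A M.Nonterminal)
  have h2 := Set.finite_range fun c : M.State × M.StackSymbol =>
    (⟨some (c.1, c.2, none), []⟩ : ContextFreeRule A M.Nonterminal)
  have h3 : (⋃ c : M.State × A × M.StackSymbol × Option M.State,
      ⋃ d ∈ {d | M.read c.1 c.2.1 c.2.2.1 = some d},
        (fun s => (⟨some (c.1, c.2.2.1, c.2.2.2), .terminal c.2.1 :: s⟩ :
          ContextFreeRule A M.Nonterminal)) '' M.expansions c.2.2.2 d.1 d.2).Finite :=
    Set.finite_iUnion fun c => (hsome _).biUnion fun d _ => (M.finite_expansions _ _ _).image _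
  have h4 : (⋃ c : M.State × M.StackSymbol × Option M.State,
      ⋃ d ∈ {d | M.eps c.1 c.2.1 = some d},
        (fun s => (⟨some c, s⟩ : ContextFreeRule A M.Nonterminal)) ''
          M.expansions c.2.2 d.1 d.2).Finite :=
    Set.finite_iUnion fun c => (hsome _).biUnion fun d _ => (M.finite_expansions _ _ _).image _
  refine (((h1.union h2).union h3).union h4).subset ?_
  rintro _ (⟨h⟩ | ⟨X, h⟩ | ⟨h, hs⟩ | ⟨h, hs⟩)
  · exact .inl (.inl (.inl ⟨_, h, rfl⟩))
  · exact .inl (.inl (.inr ⟨(_, X), rfl⟩))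
  · refine .inl (.inr (Set.mem_iUnion.2 ⟨(_, _, _, _), Set.mem_biUnion h ⟨_, hs, rfl⟩⟩))
  · exact .inr (Set.mem_iUnion.2 ⟨(_, _, _), Set.mem_biUnion h ⟨_, hs, rfl⟩⟩)

/-- The grammar of an automaton, by the triple construction. -/
noncomputable abbrev grammar [Finite A] : ContextFreeGrammar A where
  NT := M.Nonterminal
  initial := none
  rules := M.finite_setOf_isRule.toFinset

/-- The languages that the nonterminals of `M.grammar` are meant to generate. -/
def meaning : M.Nonterminal → Language A
  | none => M.wordsTo none M.start [M.bottom]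
  | some (q, X, o) => M.wordsTo o q [X]

variable {M}

theorem denotation_le_wordsTo {o : Option M.State} {q : M.State} {γ : List M.StackSymbol}
    {s : List (Symbol A M.Nonterminal)} (hs : s ∈ M.expansions o q γ) :
    ContextFreeGrammar.denotation M.meaning s ≤ M.wordsTo o q γ := by
  induction γ generalizing q s with
  | nil =>
    obtain ⟨rfl, h⟩ := hs
    rintro _ rfl
    exact ⟨q, [], h, .refl⟩
  | cons Y γ ih =>
    rcases hs with ⟨rfl, rfl⟩ | hs
    · rw [ContextFreeGrammar.denotation_nonterminal, ContextFreeGrammar.denotation_nil, mul_one]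
      rintro x ⟨q', β, hq, hr⟩
      exact ⟨q', β ++ γ, hq, by simpa using hr.append [] γ⟩
    · obtain ⟨p, s, hs', rfl⟩ := Set.mem_iUnion.1 hs
      rw [ContextFreeGrammar.denotation_nonterminal]
      intro x hx
      obtain ⟨y, ⟨_, _, ⟨rfl, rfl⟩, hy⟩, z, hz, rfl⟩ := Language.mem_mul.1 hx
      obtain ⟨q', β, hq, hr⟩ := ih hs' hz
      exact ⟨q', β, hq, (hy.append z γ).trans hr⟩

theorem denotation_le_meaning {r : ContextFreeRule A M.Nonterminal} (hr : M.IsRule r) :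
    ContextFreeGrammar.denotation M.meaning r.output ≤ M.meaning r.input := by
  cases hr with
  | start h => exact denotation_le_wordsTo h
  | final X h =>
    rintro _ rfl
    exact ⟨_, [X], h, .refl⟩
  | read h hs =>
    intro x hx
    obtain ⟨_, rfl, z, hz, rfl⟩ := Language.mem_mul.1 hx
    obtain ⟨q', β, hq, hr⟩ := denotation_le_wordsTo hs hz
    exact ⟨q', β, hq, .head (.read z [] h) (by simpa using hr)⟩
  | eps h hs =>
    intro x hx
    obtain ⟨q', β, hq, hr⟩ := denotation_le_wordsTo hs hx
    exact ⟨q', β, hq, .head (.eps x [] h) (by simpa using hr)⟩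

/-- A way to process the stack `γ ++ β` processes `γ` and then `β`, unless the final state is
already reached while `γ` is processed. -/
theorem expansions_append {o : Option M.State} {q : M.State} {γ β : List M.StackSymbol}
    {s : List (Symbol A M.Nonterminal)} (hs : s ∈ M.expansions o q (γ ++ β)) :
    (o = none ∧ s ∈ M.expansions none q γ) ∨
      ∃ p, ∃ s₁ ∈ M.expansions (some p) q γ, ∃ s₂ ∈ M.expansions o p β, s = s₁ ++ s₂ := by
  induction γ generalizing q s with
  | nil => exact .inr ⟨q, [], ⟨rfl, rfl, rfl⟩, s, hs, rfl⟩
  | cons Y γ ih =>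
    rcases hs with ⟨rfl, rfl⟩ | hs
    · exact .inl ⟨rfl, .inl ⟨rfl, rfl⟩⟩
    · obtain ⟨p, s, hs', rfl⟩ := Set.mem_iUnion.1 hs
      rcases ih hs' with ⟨rfl, hs''⟩ | ⟨p', s₁, h₁, s₂, h₂, rfl⟩
      · exact .inl ⟨rfl, .inr (Set.mem_iUnion.2 ⟨p, s, hs'', rfl⟩)⟩
      · exact .inr ⟨p', _, .inr (Set.mem_iUnion.2 ⟨p, s₁, h₁, rfl⟩), s₂, h₂, rfl⟩

theorem derives_of_isRule [Finite A] {r : ContextFreeRule A M.Nonterminal} (hr : M.IsRule r) :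
    M.grammar.Derives [.nonterminal r.input] r.output :=
  ContextFreeGrammar.derives_of_mem_rules (g := M.grammar) (M.finite_setOf_isRule.mem_toFinset.2 hr)

/-- If the topmost stack symbol `X` is replaced by `γ` in a move that reads `x`, then a derivation
for the new stack yields one for the old stack. -/
theorem exists_expansion_of_move [Finite A] {q q' : M.State} {X : M.StackSymbol}
    {γ β : List M.StackSymbol} {o : Option M.State} {x y : List A}
    (hrule : ∀ {o s}, s ∈ M.expansions o q' γ → M.IsRule ⟨some (q, X, o), x.map .terminal ++ s⟩)
    (h : ∃ s ∈ M.expansions o q' (γ ++ β), M.grammar.Derives s (y.map .terminal)) :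
    ∃ s ∈ M.expansions o q (X :: β), M.grammar.Derives s ((x ++ y).map .terminal) := by
  obtain ⟨s, hs, hd⟩ := h
  rw [List.map_append]
  rcases expansions_append hs with ⟨rfl, hs'⟩ | ⟨p, s₁, h₁, s₂, h₂, rfl⟩
  · exact ⟨_, .inl ⟨rfl, rfl⟩, (derives_of_isRule (hrule hs')).trans (hd.append_left _)⟩
  · refine ⟨_, .inr (Set.mem_iUnion.2 ⟨p, s₂, h₂, rfl⟩), ?_⟩
    have := (derives_of_isRule (hrule h₁)).append_right s₂
    rw [List.append_assoc] at this
    exact this.trans (hd.append_left _)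

theorem exists_expansion_of_runs [Finite A] {o : Option M.State} {c d : M.Config}
    (hd : M.Goal o d.1 d.2.2) (hd' : d.2.1 = []) (h : M.Runs c d) :
    ∃ s ∈ M.expansions o c.1 c.2.2, M.grammar.Derives s (c.2.1.map .terminal) := by
  induction h using Relation.ReflTransGen.head_induction_on with
  | refl =>
    rw [hd']
    obtain ⟨q, x, β⟩ := d
    cases β with
    | nil => exact ⟨[], ⟨rfl, hd⟩, .refl _⟩
    | cons Y β =>
      cases o with
      | none => exact ⟨_, .inl ⟨rfl, rfl⟩, derives_of_isRule (.final Y hd)⟩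
      | some p => cases hd.2
  | head h _ ih =>
    cases h with
    | @read _ _ a _ _ x β h => exact exists_expansion_of_move (x := [a]) (fun hs => .read h hs) ih
    | eps x β h => exact exists_expansion_of_move (x := []) (fun hs => .eps h hs) ih

theorem language_grammar [Finite A] (M : DPDA A) : M.grammar.language = M.language := by
  ext x
  constructor
  · intro h
    have := ContextFreeGrammar.mem_of_derives (g := M.grammar) M.meaning
      (fun r hr => denotation_le_meaning (M.finite_setOf_isRule.mem_toFinset.1 hr)) h
    obtain ⟨_, ⟨q, β, hq, hr⟩, _, rfl, rfl⟩ := Language.mem_mul.1 this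
    rw [List.append_nil]
    exact ⟨q, hq, β, hr⟩
  · rintro ⟨q, hq, β, hr⟩
    obtain ⟨s, hs, hd⟩ := exists_expansion_of_runs (o := none) (d := (q, [], β)) hq rfl hr
    exact (derives_of_isRule (.start hs)).trans hd

end DPDA

theorem DCFL_subset_CFL (A : Type u) [Finite A] : DCFL A ⊆ CFL A := by
  rintro _ ⟨M, rfl⟩
  exact ⟨M.grammar, M.language_grammar⟩

/-! ### A grammar for palindromes with an end marker -/

/-- The rules for palindromes with an end marker.  The nonterminal `true` generates the
palindromes, and the initial nonterminal `false` adds the end marker. -/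
inductive PalindromeRule (A : Type u) : ContextFreeRule (Option A) Bool → Prop
  | marker : PalindromeRule A ⟨false, [.nonterminal true, .terminal none]⟩
  | nil : PalindromeRule A ⟨true, []⟩
  | singleton (a : A) : PalindromeRule A ⟨true, [.terminal (some a)]⟩
  | wrap (a : A) : PalindromeRule A
      ⟨true, [.terminal (some a), .nonterminal true, .terminal (some a)]⟩

theorem finite_setOf_palindromeRule (A : Type u) [Finite A] : {r | PalindromeRule A r}.Finite := by
  refine ((((Set.finite_singleton ⟨false, [.nonterminal true, .terminal none]⟩).union
    (Set.finite_singleton ⟨true, []⟩)).union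
    (Set.finite_range fun a : A => ⟨true, [.terminal (some a)]⟩)).union
    (Set.finite_range fun a : A =>
      ⟨true, [.terminal (some a), .nonterminal true, .terminal (some a)]⟩)).subset ?_
  rintro _ (_ | _ | a | a)
  · exact .inl (.inl (.inl rfl))
  · exact .inl (.inl (.inr rfl))
  · exact .inl (.inr ⟨a, rfl⟩)
  · exact .inr ⟨a, rfl⟩

/-- The grammar of palindromes with an end marker. -/
noncomputable abbrev palindromeGrammar (A : Type u) [Finite A] : ContextFreeGrammar (Option A) where
  NT := Bool
  initial := false
  rules := (finite_setOf_palindromeRule A).toFinset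

/-- The languages that the nonterminals of `palindromeGrammar A` are meant to generate. -/
def palindromeMeaning (A : Type u) : Bool → Language (Option A)
  | false => palindromesDollar A
  | true => {y | ∃ x ∈ palindromes A, y = x.map some}

theorem derives_of_palindromeRule {A : Type u} [Finite A] {r : ContextFreeRule (Option A) Bool}
    (hr : PalindromeRule A r) :
    (palindromeGrammar A).Derives [.nonterminal r.input] r.output :=
  ContextFreeGrammar.derives_of_mem_rules (g := palindromeGrammar A)
    ((finite_setOf_palindromeRule A).mem_toFinset.2 hr)

theorem palindromeGrammar_derives {A : Type u} [Finite A] {x : List A} (hx : x.Palindrome) :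
    (palindromeGrammar A).Derives [.nonterminal true] ((x.map some).map .terminal) := by
  induction hx with
  | nil => exact derives_of_palindromeRule .nil
  | singleton a => exact derives_of_palindromeRule (.singleton a)
  | @cons_concat a x _ ih =>
    refine (derives_of_palindromeRule (.wrap a)).trans ?_
    simpa using (ih.append_left [.terminal (some a)]).append_right [.terminal (some a)]

theorem language_palindromeGrammar (A : Type u) [Finite A] :
    (palindromeGrammar A).language = palindromesDollar A := by
  ext x
  constructor
  · intro h
    have key := ContextFreeGrammar.mem_of_derives (g := palindromeGrammar A) (palindromeMeaning A)
      ?_ h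
    · obtain ⟨y, hy, _, rfl, rfl⟩ := Language.mem_mul.1 key
      rw [List.append_nil]
      exact hy
    intro r hr y hy
    rcases (finite_setOf_palindromeRule A).mem_toFinset.1 hr with _ | _ | a | a
    · obtain ⟨_, ⟨x, hx, rfl⟩, _, ⟨_, rfl, _, rfl, rfl⟩, rfl⟩ := hy
      exact ⟨x, hx, rfl⟩
    · obtain rfl : y = [] := hy
      exact ⟨[], rfl, rfl⟩
    · obtain ⟨_, rfl, _, rfl, rfl⟩ := hy
      exact ⟨[a], rfl, rfl⟩
    · obtain ⟨_, rfl, _, ⟨_, ⟨x, hx, rfl⟩, _, ⟨_, rfl, _, rfl, rfl⟩, rfl⟩, rfl⟩ := hy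
      refine ⟨a :: (x ++ [a]), ?_, by simp⟩
      have hx : x.reverse = x := hx
      change (a :: (x ++ [a])).reverse = _
      simp [hx]
  · rintro ⟨x, hx, rfl⟩
    refine (derives_of_palindromeRule .marker).trans ?_
    simpa using (palindromeGrammar_derives (.of_reverse_eq hx)).append_right [.terminal none]

/-! ### Collisions -/

/-- The words that can still be read after a word without end marker: the end marker occurs at most
once, as last letter. -/
def MarkedAtMostAtEnd {A : Type u} (e : List (Option A)) : Prop :=
  ∃ z : List A, e = z.map some ∨ e = z.map some ++ [none]

theorem MarkedAtMostAtEnd.map_some_append {A : Type u} {e : List (Option A)}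
    (he : MarkedAtMostAtEnd e) (x : List A) : MarkedAtMostAtEnd (x.map some ++ e) := by
  obtain ⟨z, rfl | rfl⟩ := he
  · exact ⟨x ++ z, .inl (by simp)⟩
  · exact ⟨x ++ z, .inr (by simp)⟩

/-- The end marker does not occur in a proper prefix. -/
theorem MarkedAtMostAtEnd.exists_of_append {A : Type u} {x y : List (Option A)}
    (h : MarkedAtMostAtEnd (x ++ y)) (hy : y ≠ []) : ∃ z : List A, x = z.map some := by
  obtain ⟨z, h | h⟩ := h
  · obtain ⟨z₁, z₂, -, rfl, -⟩ := List.map_eq_append_iff.1 h.symm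
    exact ⟨z₁, rfl⟩
  · rw [← List.dropLast_append_getLast hy, ← List.append_assoc] at h
    obtain ⟨z₁, z₂, -, rfl, -⟩ := List.map_eq_append_iff.1 (List.append_inj_left' h rfl).symm
    exact ⟨z₁, rfl⟩

/-- `x` and `x'` have the same nonempty continuations in `L`.  The empty continuation is excluded
because it is the only one that can be accepted by spontaneous moves alone. -/
def SameContinuations {A : Type u} (L : Language (Option A)) (x x' : List A) : Prop :=
  ∀ e, MarkedAtMostAtEnd e → e ≠ [] → (x.map some ++ e ∈ L ↔ x'.map some ++ e ∈ L)

/-- Another word of the same length has all continuations that `x` has in `L`. -/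
def HasCollision {A : Type u} (L : Language (Option A)) (x : List A) : Prop :=
  ∃ x', x' ≠ x ∧ x'.length = x.length ∧
    ∀ e, MarkedAtMostAtEnd e → x.map some ++ e ∈ L → x'.map some ++ e ∈ L

section

variable {A : Type u} {L : Language (Option A)} {x y z : List A}

theorem SameContinuations.symm (h : SameContinuations L x y) : SameContinuations L y x :=
  fun e he he' => (h e he he').symm

theorem SameContinuations.trans (h : SameContinuations L x y) (h' : SameContinuations L y z) :
    SameContinuations L x z :=
  fun e he he' => (h e he he').trans (h' e he he')

theorem SameContinuations.append (h : SameContinuations L x y) (z : List A) :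
    SameContinuations L (x ++ z) (y ++ z) := by
  intro e he he'
  rw [List.map_append, List.map_append, List.append_assoc, List.append_assoc]
  exact h _ (he.map_some_append z) (by simp [he'])

theorem HasCollision.append (h : HasCollision L x) (z : List A) : HasCollision L (x ++ z) := by
  obtain ⟨x', hne, hlen, hx⟩ := h
  refine ⟨x' ++ z, fun h => hne (List.append_cancel_right h), by simp [hlen], fun e he => ?_⟩
  rw [List.map_append, List.map_append, List.append_assoc, List.append_assoc]
  exact hx _ (he.map_some_append z)

end

namespace DPDA

variable {A : Type u} (M : DPDA (Option A))

/-- Some run from the initial configuration reads `x` and ends in state `q` with stack `β`. -/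
def Reaches (x : List A) (q : M.State) (β : List M.StackSymbol) : Prop :=
  M.Runs (M.start, x.map some, [M.bottom]) (q, [], β)

/-- The states from which the stack `β` leads to acceptance by spontaneous moves. -/
def acceptingStates (β : List M.StackSymbol) : Set M.State := {p | [] ∈ M.wordsTo none p β}

/-- `M.HasType x t`: the type `t` determines the continuations of `x`.
Type `none`: no configuration is reached by reading `x`.  Type `some (q, none, _)`: state `q` is
reached with empty stack.  Type `some (q, some X, F)`: state `q` is reached with topmost stack
symbol `X`, the stack below `X` is exposed by no continuation of `x` without end marker, and if it
is exposed after the end of the input then exactly the states in `F` lead to acceptance. -/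
def HasType (x : List A) : Option (M.State × Option M.StackSymbol × Set M.State) → Prop
  | none => ∀ q β, ¬ M.Reaches x q β
  | some (q, none, _) => M.Reaches x q []
  | some (q, some X, F) => ∃ β, M.Reaches x q (X :: β) ∧ M.acceptingStates β = F ∧
      ∀ z q' β', M.Reaches (x ++ z) q' β' → β.length < β'.length

variable {M}

theorem exists_reaches_of_append_mem {x : List A} {e : List (Option A)}
    (h : x.map some ++ e ∈ M.language) : ∃ q β, M.Reaches x q β := by
  obtain ⟨q, -, β, h⟩ := h
  obtain ⟨q', β', h', -⟩ := Runs.split h rfl rfl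
  exact ⟨q', β', h'⟩

theorem append_mem_language_iff {x : List A} {q : M.State} {β : List M.StackSymbol}
    (h : M.Reaches x q β) {e : List (Option A)} (he : e ≠ []) :
    x.map some ++ e ∈ M.language ↔ e ∈ M.wordsTo none q β := by
  have h' : M.Runs (M.start, x.map some ++ e, [M.bottom]) (q, e, β) := by
    simpa using Runs.append h e []
  constructor
  · rintro ⟨q', hq, β', hr⟩
    rcases Relation.ReflTransGen.total_of_right_unique Step.rightUnique h' hr with hr | hr
    · exact ⟨q', β', hq, hr⟩
    · obtain ⟨y, hy, -⟩ := Runs.exists_prefix hr (y := e) (z := []) rfl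
      exact absurd (List.append_eq_nil_iff.1 hy.symm).2 he
  · rintro ⟨q', β', hq, hr⟩
    exact ⟨q', hq, β', h'.trans hr⟩

theorem notMem_wordsTo_nil {q : M.State} {e : List (Option A)} (he : e ≠ [])
    (o : Option M.State) : e ∉ M.wordsTo o q [] := by
  rintro ⟨q', β', -, hr⟩
  rcases hr.cases_head with hr | ⟨c, hr, -⟩
  · cases hr
    exact he rfl
  · cases hr

theorem append_mem_language_of_hasType {x y : List A}
    {t : Option (M.State × Option M.StackSymbol × Set M.State)} (hx : M.HasType x t)
    (hy : M.HasType y t) {e : List (Option A)} (he : MarkedAtMostAtEnd e) (he' : e ≠ [])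
    (h : x.map some ++ e ∈ M.language) : y.map some ++ e ∈ M.language := by
  match t with
  | none =>
    obtain ⟨q, β, h⟩ := exists_reaches_of_append_mem h
    exact absurd h (hx q β)
  | some (q, none, _) =>
    exact absurd ((append_mem_language_iff hx he').1 h) (notMem_wordsTo_nil he' _)
  | some (q, some X, F) =>
    obtain ⟨β, hβ, hF, hmin⟩ := hx
    obtain ⟨δ, hδ, hF', -⟩ := hy
    rw [append_mem_language_iff hβ he'] at h
    rw [append_mem_language_iff hδ he']
    obtain ⟨q', β', hq, hr⟩ := h
    rcases Runs.untouched_or_popped (γ := [X]) hr with ⟨ε, -, hr'⟩ | ⟨p, e₂, h₁, h₂⟩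
    · exact ⟨q', ε ++ δ, hq, by simpa using hr'.append [] δ⟩
    obtain ⟨e₁, rfl, h₁'⟩ := h₁.exists_prefix (y := e₂) (z := []) rfl
    by_cases h : e₂ = []
    · subst h
      have hp : p ∈ M.acceptingStates δ := by
        rw [hF', ← hF]
        exact ⟨q', β', hq, h₂⟩
      obtain ⟨q'', δ', hq', hr'⟩ := hp
      refine ⟨q'', δ', hq', ?_⟩
      have := h₁'.append [] δ
      rw [List.append_nil] at this ⊢
      exact this.trans hr'
    · obtain ⟨z, rfl⟩ := he.exists_of_append h
      -- The stack below `X` would be exposed by the continuation `z`.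
      refine absurd (hmin z p β ?_) (lt_irrefl _)
      have h₀ := Runs.append hβ (z.map some) []
      have h₃ := h₁'.append [] β
      rw [List.append_nil] at h₃
      simp only [List.append_nil, List.nil_append] at h₀ h₃
      rw [Reaches, List.map_append]
      exact h₀.trans h₃

theorem sameContinuations_of_hasType {x y : List A}
    {t : Option (M.State × Option M.StackSymbol × Set M.State)} (hx : M.HasType x t)
    (hy : M.HasType y t) : SameContinuations M.language x y := fun _ he he' =>
  ⟨append_mem_language_of_hasType hx hy he he', append_mem_language_of_hasType hy hx he he'⟩

/-- Every word can be extended such that it has a type: the stack height is made minimal. -/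
theorem exists_hasType (M : DPDA (Option A)) (x : List A) : ∃ z t, M.HasType (x ++ z) t := by
  by_cases hdead : ∃ z, ∀ q β, ¬ M.Reaches (x ++ z) q β
  · obtain ⟨z, hz⟩ := hdead
    exact ⟨z, none, hz⟩
  push Not at hdead
  let S : Set (List A × M.State × List M.StackSymbol) := {c | M.Reaches (x ++ c.1) c.2.1 c.2.2}
  have hS : S.Nonempty := by
    obtain ⟨q, β, h⟩ := hdead []
    exact ⟨([], q, β), h⟩
  obtain ⟨⟨z, q, β⟩, hz, hmin⟩ :=
    (measure fun c : List A × M.State × List M.StackSymbol => c.2.2.length).wf.has_min S hS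
  refine ⟨z, ?_⟩
  cases β with
  | nil => exact ⟨some (q, none, ∅), hz⟩
  | cons X β =>
    refine ⟨some (q, some X, _), β, hz, rfl, fun z' q' β' h => ?_⟩
    have := hmin (z ++ z', q', β') (by rwa [List.append_assoc] at h)
    exact Nat.lt_of_succ_le (not_lt.1 this)

/-- Every word has an extension to which it can return, up to continuations, after any further
extension: the extension has a type that is never lost. -/
theorem exists_recurrent (M : DPDA (Option A)) (x : List A) :
    ∃ z, ∀ y, ∃ y', SameContinuations M.language (x ++ z) (x ++ z ++ y ++ y') := by
  have := M.finite_state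
  have := M.finite_stackSymbol
  let R (x : List A) : Set (Option (M.State × Option M.StackSymbol × Set M.State)) :=
    {t | ∃ z, M.HasType (x ++ z) t}
  have hR (x y : List A) : R (x ++ y) ⊆ R x := by
    rintro t ⟨z, hz⟩
    exact ⟨y ++ z, by rwa [List.append_assoc] at hz⟩
  obtain ⟨_, ⟨z, rfl⟩, hmin⟩ :=
    (wellFounded_lt (α := Set (Option (M.State × Option M.StackSymbol × Set M.State)))).has_min
      (Set.range fun z => R (x ++ z)) (Set.range_nonempty _)
  obtain ⟨z', t, ht⟩ := M.exists_hasType (x ++ z)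
  refine ⟨z ++ z', fun y => ?_⟩
  have hmem : t ∈ R (x ++ z ++ (z' ++ y)) := by
    by_contra hn
    refine hmin (R (x ++ (z ++ (z' ++ y)))) ⟨_, rfl⟩ ?_
    rw [← List.append_assoc]
    exact (hR _ _).ssubset_of_mem_notMem ⟨z', ht⟩ hn
  obtain ⟨y', hy'⟩ := hmem
  refine ⟨y', sameContinuations_of_hasType (t := t) ?_ ?_⟩
  · rwa [← List.append_assoc]
  · simpa only [List.append_assoc] using hy'

end DPDA

/-- In a deterministic context-free language every word has an extension with a collision.  After a
suitable extension of `x` there are words `y` and `y'` with different first letters that both lead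
back to it up to continuations; hence `y ++ y'` and `y' ++ y` have the same continuations there. -/
theorem exists_hasCollision {A : Type u} [Nontrivial A] {L : Language (Option A)}
    (hL : L ∈ DCFL (Option A)) (x : List A) : ∃ z, HasCollision L (x ++ z) := by
  obtain ⟨M, rfl⟩ := hL
  obtain ⟨z, hz⟩ := M.exists_recurrent x
  obtain ⟨a, b, hab⟩ := exists_pair_ne A
  obtain ⟨y, hy⟩ := hz [a]
  obtain ⟨y', hy'⟩ := hz [b]
  have key : SameContinuations M.language (x ++ z ++ [a] ++ y ++ [b] ++ y')
      (x ++ z ++ [b] ++ y' ++ [a] ++ y) :=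
    ((((hy.append [b]).append y').symm.trans hy'.symm).trans hy).trans
      ((hy'.append [a]).append y)
  -- One more letter turns all continuations into nonempty ones.
  refine ⟨z ++ [a] ++ y ++ [b] ++ y' ++ [a], x ++ z ++ [b] ++ y' ++ [a] ++ y ++ [a], ?_, ?_, ?_⟩
  · intro h
    simp only [List.append_assoc, List.append_cancel_left_eq, List.cons_append, List.nil_append,
      List.cons.injEq] at h
    exact hab h.1.symm
  · simp only [List.length_append, List.length_singleton]
    omega
  · intro e he h
    have := key ([a].map some ++ e) (he.map_some_append [a]) (by simp)
    simp only [List.map_append, List.append_assoc] at this h ⊢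
    exact this.1 h

/-- Collisions can be enforced for finitely many starting points at once. -/
theorem exists_forall_hasCollision {A : Type u} [Nontrivial A] {L : Language (Option A)}
    (hL : L ∈ DCFL (Option A)) (x : List A) (N : ℕ) (hN : N ≤ x.length + 1) :
    ∃ z, ∀ k < N, HasCollision L ((x ++ z).drop k) := by
  induction N with
  | zero => exact ⟨[], by simp⟩
  | succ N ih =>
    obtain ⟨z, hz⟩ := ih (by omega)
    obtain ⟨z', hz'⟩ := exists_hasCollision hL ((x ++ z).drop N)
    have hdrop (k : ℕ) (hk : k ≤ N) : (x ++ (z ++ z')).drop k = (x ++ z).drop k ++ z' := by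
      rw [← List.append_assoc, List.drop_append_of_le_length]
      rw [List.length_append]
      omega
    refine ⟨z ++ z', fun k hk => ?_⟩
    rw [hdrop k (by omega)]
    rcases Nat.lt_succ_iff_lt_or_eq.1 hk with hk | rfl
    · exact (hz k hk).append z'
    · exact hz'

/-! ### Paths in transition systems -/

namespace LTS

variable {A : Type u} {P : Type v} {T : LTS.{u, v, w} A P}

theorem Path.append {s t r : T.State} {x y : List A} (h : T.Path s x t) (h' : T.Path t y r) :
    T.Path s (x ++ y) r := by
  induction h with
  | nil => exact h'
  | cons h _ ih => exact .cons h (ih h')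

theorem Path.split {s r : T.State} {x y : List A} (h : T.Path s (x ++ y) r) :
    ∃ t, T.Path s x t ∧ T.Path t y r := by
  induction x generalizing s with
  | nil => exact ⟨s, .nil s, h⟩
  | cons a x ih =>
    cases h with
    | cons h h' =>
      obtain ⟨t, h₁, h₂⟩ := ih h'
      exact ⟨t, .cons h h₁, h₂⟩

theorem Path.eq_of_nil {s t : T.State} (h : T.Path s [] t) : s = t := by
  cases h
  rfl

theorem Path.exists_of_cons {s r : T.State} {a : A} {x : List A} (h : T.Path s (a :: x) r) :
    ∃ t, T.Trans s a t ∧ T.Path t x r := by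
  cases h with
  | cons h h' => exact ⟨_, h, h'⟩

/-! ### The separating structure -/

/-- The structure in which only the word `u` distinguishes two states.  A state is a pair of a layer
and a flag.  In the first `u.length` layers every letter of `A` leads from every state to both
states of the next layer, except that the `k`-th letter of `u` does not lead from `(k, false)` to
`(k + 1, true)`.  After that only the flag `true` can proceed, by reading the reversal of `u`
followed by the end marker. -/
def separating (P : Type v) (u : List A) : LTS.{u, v, w} (Option A) P where
  State := ULift.{w} (ℕ × Bool)
  Trans s a t := t.down.1 = s.down.1 + 1 ∧
    ((s.down.1 < u.length ∧
        ∃ c, a = some c ∧ (s.down.2 = false → t.down.2 = true → u[s.down.1]? ≠ some c)) ∨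
      (u.length ≤ s.down.1 ∧ s.down.2 = true ∧ t.down.2 = true ∧
        (u.reverse.map some ++ [none])[s.down.1 - u.length]? = some a))
  val _ := ∅

namespace separating

variable {u : List A}

/-- The state in layer `k` with flag `b`. -/
abbrev state (P : Type v) (u : List A) (k : ℕ) (b : Bool) : (separating.{u, v, w} P u).State :=
  ⟨(k, b)⟩

theorem layer_eq {s t : (separating.{u, v, w} P u).State} {x : List (Option A)} (h : Path _ s x t) :
    t.down.1 = s.down.1 + x.length := by
  induction h with
  | nil => rfl
  | cons h _ ih =>
    rw [ih, h.1, List.length_cons]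
    omega

/-- Every nonempty word within the first layers leads from any flag to any flag, except that the
passage from `false` to `true` depends on the word. -/
theorem path_true {k : ℕ} {z : List A} (hz : z ≠ []) (hk : k + z.length ≤ u.length) (b b' : Bool)
    (hb : b = true ∨ b' = false) :
    Path _ (state.{u, v, w} P u k b) (z.map some) (state P u (k + z.length) b') := by
  induction z generalizing k b with
  | nil => exact absurd rfl hz
  | cons a z ih =>
    rw [List.length_cons] at hk ⊢
    by_cases h : z = []
    · subst h
      refine .cons (s' := state P u (k + 1) b') ⟨rfl, .inl ⟨?_, a, rfl, ?_⟩⟩ (.nil _)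
      · change k < _
        omega
      · rintro (rfl : b = false) (rfl : b' = true)
        simp at hb
    · rw [show k + (z.length + 1) = k + 1 + z.length by omega]
      refine .cons (s' := state P u (k + 1) b) ⟨rfl, .inl ⟨?_, a, rfl, ?_⟩⟩ (ih h (by omega) b hb)
      · change k < _
        omega
      · rintro (rfl : b = false) (h : false = true)
        cases h

/-- From a state with flag `false`, every word within the first layers leads to the flag `false`. -/
theorem path_false_false {k : ℕ} {z : List A} (hk : k + z.length ≤ u.length) :
    Path _ (state.{u, v, w} P u k false) (z.map some) (state P u (k + z.length) false) := by
  by_cases h : z = []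
  · subst h
    exact .nil _
  · exact path_true h hk _ _ (.inr rfl)

/-- From a state with flag `false`, every word that deviates from `u` leads to both flags. -/
theorem path_of_ne {k : ℕ} {z : List A} (hk : k + z.length ≤ u.length)
    (hz : z ≠ (u.drop k).take z.length) (b : Bool) :
    Path _ (state.{u, v, w} P u k false) (z.map some) (state P u (k + z.length) b) := by
  induction z generalizing k with
  | nil => simp at hz
  | cons a z ih =>
    rw [List.length_cons] at hk hz ⊢
    have hlt : k < u.length := by omega
    rw [show k + (z.length + 1) = k + 1 + z.length by omega]
    by_cases ha : u[k] = a
    · rw [List.drop_eq_getElem_cons hlt, List.take_succ_cons, ha] at hz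
      refine .cons (s' := state P u (k + 1) false) ⟨rfl, .inl ⟨hlt, a, rfl, ?_⟩⟩
        (ih (by omega) fun h => hz (by rw [← h]))
      rintro - (h : false = true)
      cases h
    · have hstep (b' : Bool) : LTS.Trans _ (state P u k false) (some a) (state P u (k + 1) b') := by
        refine ⟨rfl, .inl ⟨hlt, a, rfl, fun _ _ h => ha ?_⟩⟩
        rw [List.getElem?_eq_getElem hlt] at h
        exact Option.some_injective _ h
      by_cases h : z = []
      · subst h
        exact .cons (hstep b) (.nil _)
      · exact .cons (hstep true) (path_true h (by omega) _ _ (.inl rfl))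

/-- From a state with flag `false`, the flag `true` is not reached by reading a factor of `u`. -/
theorem ne_of_path {k : ℕ} {z : List A} (hk : k + z.length ≤ u.length)
    (h : Path _ (state.{u, v, w} P u k false) (z.map some) (state P u (k + z.length) true)) :
    z ≠ (u.drop k).take z.length := by
  induction z generalizing k with
  | nil => cases h
  | cons a z ih =>
    rw [List.length_cons] at hk h ⊢
    have hlt : k < u.length := by omega
    rw [show k + (z.length + 1) = k + 1 + z.length by omega] at h
    rw [List.drop_eq_getElem_cons hlt, List.take_succ_cons]
    cases h with
    | @cons _ s' _ _ _ h h' =>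
      obtain ⟨⟨k', b⟩⟩ := s'
      obtain rfl : k' = k + 1 := h.1
      intro he
      obtain ⟨rfl, he'⟩ := List.cons_eq_cons.1 he
      cases b with
      | false => exact ih (by omega) h' he'
      | true =>
        rcases h.2 with ⟨-, c, hc, h⟩ | ⟨h, -⟩
        · obtain rfl := Option.some_injective _ hc
          exact h rfl rfl (List.getElem?_eq_getElem hlt)
        · exact absurd hlt (not_lt.2 h)

/-- The flag `true` allows every step that the flag `false` allows. -/
theorem path_true_of_path_false {k : ℕ} {y : List (Option A)} (hy : y ≠ [])
    {t : (separating.{u, v, w} P u).State}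
    (h : Path _ (state P u k false) y t) : Path _ (state P u k true) y t := by
  cases h with
  | nil => exact absurd rfl hy
  | cons h h' =>
    refine .cons ⟨h.1, ?_⟩ h'
    rcases h.2 with ⟨hk, c, hc, -⟩ | ⟨-, h, -⟩
    · exact .inl ⟨hk, c, hc, fun h => by cases h⟩
    · cases h

/-- The first layers are passed by letters of `A`. -/
theorem exists_eq_map_some_append {s t : (separating.{u, v, w} P u).State} {y : List (Option A)}
    (h : Path _ s y t)
    {m : ℕ} (hs : s.down.1 + m ≤ u.length) (hm : m ≤ y.length) :
    ∃ (z : List A) (e : List (Option A)), z.length = m ∧ y = z.map some ++ e := by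
  induction h generalizing m with
  | nil =>
    obtain rfl : m = 0 := by simpa using hm
    exact ⟨[], [], rfl, rfl⟩
  | @cons s s' t a y h _ ih =>
    cases m with
    | zero => exact ⟨[], a :: y, rfl, rfl⟩
    | succ m =>
      obtain ⟨z, e, rfl, rfl⟩ := ih (m := m) (by rw [h.1]; omega) (by simpa using hm)
      rcases h.2 with ⟨-, c, rfl, -⟩ | ⟨h, -⟩
      · exact ⟨c :: z, e, rfl, rfl⟩
      · omega

/-- From the last of the first layers on, only the reversal of `u` and the end marker are read. -/
theorem eq_take_of_path {s t : (separating.{u, v, w} P u).State} {y : List (Option A)}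
    (h : Path _ s y t)
    (hs : u.length ≤ s.down.1) :
    y = ((u.reverse.map some ++ [none]).drop (s.down.1 - u.length)).take y.length := by
  induction h with
  | nil => rfl
  | @cons s s' t a y h _ ih =>
    rcases h.2 with ⟨hlt, -⟩ | ⟨-, -, -, ha⟩
    · omega
    · obtain ⟨hlt, rfl⟩ := List.getElem?_eq_some_iff.1 ha
      rw [List.length_cons, List.drop_eq_getElem_cons hlt, List.take_succ_cons]
      rw [h.1] at ih
      congr 1
      rw [Nat.sub_add_comm hs] at ih
      exact ih (by omega)

theorem markedAtMostAtEnd_of_path {s t : (separating.{u, v, w} P u).State} {y : List (Option A)}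
    (h : Path _ s y t) :
    MarkedAtMostAtEnd y := by
  induction h with
  | nil => exact ⟨[], .inl rfl⟩
  | @cons s s' t a y h h' ih =>
    cases a with
    | some c => exact ih.map_some_append [c]
    | none =>
      rcases h.2 with ⟨-, c, hc, -⟩ | ⟨hle, -, -, ha⟩
      · cases hc
      · have hlt : ¬ s.down.1 - u.length < u.reverse.length := by
          intro hlt
          rw [List.getElem?_append_left (by simpa using hlt), List.getElem?_map,
            List.getElem?_eq_getElem hlt] at ha
          cases ha
        have hy := eq_take_of_path h' (by rw [h.1]; omega)
        rw [List.drop_eq_nil_of_le, List.take_nil] at hy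
        · exact ⟨[], .inr (by rw [hy]; rfl)⟩
        · rw [h.1]
          simp at hlt ⊢
          omega

/-- Reading the reversal of `u` and the end marker from the last of the first layers. -/
theorem path_reverse (k : ℕ) (hk : k ≤ u.length + 1) :
    Path _ (state.{u, v, w} P u (u.length + k) true) ((u.reverse.map some ++ [none]).drop k)
      (state P u (u.length + (u.length + 1)) true) := by
  induction hk using Nat.decreasingInduction with
  | self =>
    rw [List.drop_eq_nil_of_le (by simp)]
    exact .nil _
  | of_succ k hk ih =>
    have hlt : k < (u.reverse.map some ++ [none]).length := by simp; omega
    rw [List.drop_eq_getElem_cons hlt]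
    refine .cons (s' := state P u (u.length + (k + 1)) true) ⟨rfl, .inr ⟨?_, rfl, rfl, ?_⟩⟩ ih
    · exact Nat.le_add_right _ _
    · change _[u.length + k - u.length]? = _
      rw [Nat.add_sub_cancel_left, List.getElem?_eq_getElem hlt]

theorem sat_palFormula : (palFormula A P).Sat (separating.{u, v, w} P u) (state P u 0 true) := by
  refine ⟨(u ++ u.reverse).map some ++ [none], ⟨u ++ u.reverse, ?_, rfl⟩,
    state P u (u.length + (u.length + 1)) true, ?_, trivial⟩
  · change (u ++ u.reverse).reverse = _
    simp
  · rw [List.map_append, List.append_assoc]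
    refine Path.append (t := state P u u.length true) ?_ (path_reverse 0 (by omega))
    by_cases h : u = []
    · subst h
      exact .nil _
    · have := path_true.{u, v, w} (P := P) (u := u) (k := 0) h (by omega) true true (.inl rfl)
      rwa [Nat.zero_add] at this

theorem not_sat_palFormula :
    ¬ (palFormula A P).Sat (separating.{u, v, w} P u) (state P u 0 false) := by
  rintro ⟨_, ⟨x, hx, rfl⟩, t, h, -⟩
  obtain ⟨⟨⟨k, b⟩⟩, h₁, h₂⟩ := h.split
  have hk : k = x.length := by simpa using layer_eq h₁
  obtain ⟨hlen, rfl, hlast⟩ : u.length ≤ k ∧ b = true ∧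
      (u.reverse.map some ++ [none])[k - u.length]? = some none := by
    obtain ⟨s, h, -⟩ := h₂.exists_of_cons
    rcases h.2 with ⟨-, c, hc, -⟩ | ⟨hle, hb, -, ha⟩
    · cases hc
    · exact ⟨hle, hb, ha⟩
  have hk' : k = u.length + u.length := by
    by_contra hne
    obtain ⟨hlt, -⟩ := List.getElem?_eq_some_iff.1 hlast
    have hlt' : k - u.length < u.reverse.length := by
      simp at hlt ⊢
      omega
    rw [List.getElem?_append_left (by simpa using hlt'), List.getElem?_map,
      List.getElem?_eq_getElem hlt'] at hlast
    cases hlast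
  obtain ⟨x₁, x₂, rfl, hx₁⟩ : ∃ x₁ x₂, x = x₁ ++ x₂ ∧ x₁.length = u.length :=
    ⟨_, _, (List.take_append_drop u.length x).symm, by simp; omega⟩
  have hx₂ : x₂.length = u.length := by
    rw [List.length_append] at hk
    omega
  rw [List.map_append] at h₁
  obtain ⟨⟨⟨k', b⟩⟩, h₁, h₃⟩ := h₁.split
  obtain rfl : k' = u.length := by simpa [hx₁] using layer_eq h₁
  -- Only the flag `true` can proceed, so the first half of the word is not `u`.
  obtain rfl : b = true := by
    cases x₂ with
    | nil =>
      cases h₃.eq_of_nil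
      rfl
    | cons a x₂ =>
      obtain ⟨s, h, -⟩ := h₃.exists_of_cons
      rcases h.2 with ⟨hlt, -⟩ | ⟨-, hb, -⟩
      · exact absurd hlt (lt_irrefl _)
      · exact hb
  have hne : x₁ ≠ u := by
    have := ne_of_path.{u, v, w} (P := P) (u := u) (k := 0) (z := x₁) (by omega)
      (by rwa [hx₁, Nat.zero_add])
    rwa [hx₁, List.drop_zero, List.take_length] at this
  -- The second half is the reversal of `u`.
  have h₂' : x₂ = u.reverse := by
    have := eq_take_of_path h₃ le_rfl
    rw [Nat.sub_self, List.drop_zero, List.take_append_of_le_length (by simp [hx₂]),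
      List.take_of_length_le (by simp [hx₂])] at this
    exact List.map_injective_iff.2 (Option.some_injective _) this
  subst h₂'
  have hx : (x₁ ++ u.reverse).reverse = x₁ ++ u.reverse := hx
  rw [List.reverse_append, List.reverse_reverse] at hx
  exact hne (List.append_inj_left hx hx₁.symm).symm

/-! ### Indistinguishable states -/

/-- Up to a formula on which the two states of each layer up to the length of `p` agree, the same
states are reachable by words of `L` from both states of layer `k`.  The long words are dealt with
by a collision and the short words by the agreement. -/
theorem exists_path_of_hasCollision {L : Language (Option A)} {p : List A} (hp : p <+: u)
    {S : (separating.{u, v, w} P u).State → Prop}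
    (hS : ∀ j ≤ p.length, S (state P u j true) ↔ S (state P u j false)) {k : ℕ}
    (hk : k ≤ p.length) (hL : HasCollision L (p.drop k)) {y : List (Option A)} (hy : y ∈ L)
    {t : (separating P u).State} (ht : Path _ (state P u k true) y t) :
    ∃ y' ∈ L, ∃ t', Path _ (state P u k false) y' t' ∧ (S t ↔ S t') := by
  have hpu := hp.length_le
  rcases lt_or_ge y.length (p.length - k) with hlt | hle
  · obtain ⟨z, e, hz, he⟩ := exists_eq_map_some_append ht (m := y.length)
      (by change k + _ ≤ _; omega) le_rfl
    obtain rfl : e = [] := by simpa [hz] using congrArg List.length he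
    rw [List.append_nil] at he
    subst he
    rw [List.length_map] at hlt
    refine ⟨_, hy, state P u (k + z.length) false, path_false_false (by omega), ?_⟩
    have hl := layer_eq ht
    obtain ⟨⟨j, b⟩⟩ := t
    obtain rfl : j = k + z.length := by simpa using hl
    cases b with
    | false => rfl
    | true => exact hS _ (by omega)
  · obtain ⟨z, e, hz, rfl⟩ := exists_eq_map_some_append ht (m := p.length - k)
      (by change k + _ ≤ _; omega) hle
    obtain ⟨⟨⟨j, b⟩⟩, h₁, h₂⟩ := ht.split
    have hkz : k + z.length = p.length := by omega
    obtain rfl : j = p.length := by rw [← hkz]; simpa using layer_eq h₁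
    have hfactor : (u.drop k).take z.length = p.drop k := by
      obtain ⟨r, rfl⟩ := hp
      rw [List.drop_append_of_le_length hk, hz, List.take_append_of_le_length (by simp),
        List.take_of_length_le (by simp)]
    by_cases hzp : z = p.drop k
    · obtain ⟨z', hne, hlen, hz'⟩ := hL
      rw [← hzp] at hne hlen hz'
      refine ⟨_, hz' e (markedAtMostAtEnd_of_path h₂) hy, t, .append ?_ h₂, Iff.rfl⟩
      have := path_of_ne.{u, v, w} (P := P) (u := u) (k := k) (z := z') (by omega)
        (by rwa [hlen, hfactor, ← hzp]) b
      rwa [hlen, hkz] at this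
    · refine ⟨_, hy, t, .append ?_ h₂, Iff.rfl⟩
      have := path_of_ne.{u, v, w} (P := P) (u := u) (k := k) (z := z) (by omega)
        (by rwa [hfactor]) b
      rwa [hkz] at this

/-- Up to a formula on which the two states of layer `k` agree, every state that is reachable from
the state with flag `false` is reachable from the state with flag `true`.  The formula matters only
for the empty word. -/
theorem exists_path_of_path_false {L : Language (Option A)}
    {S : (separating.{u, v, w} P u).State → Prop} {k : ℕ}
    (hS : S (state P u k true) ↔ S (state P u k false)) {y : List (Option A)} (hy : y ∈ L)
    {t : (separating P u).State} (ht : Path _ (state P u k false) y t) :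
    ∃ y' ∈ L, ∃ t', Path _ (state P u k true) y' t' ∧ (S t ↔ S t') := by
  by_cases h : y = []
  · subst h
    obtain rfl := ht.eq_of_nil
    exact ⟨[], hy, state P u k true, .nil _, hS.symm⟩
  · exact ⟨y, hy, t, path_true_of_path_false h ht, Iff.rfl⟩

end separating

end LTS

open LTS.separating in
/-- For a formula over deterministic context-free languages, every word `p` has an extension such
that the formula does not distinguish the two states of any layer up to `N`, in all structures
`LTS.separating P u` for further extensions `u`.  A program needs collisions at all these layers;
they are enforced first, and the induction hypothesis is then applied to the longer word that they
require, with its length as new bound. -/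
theorem PDLFormula.exists_forall_sat_iff {A : Type u} {P : Type v} [Nontrivial A]
    (φ : PDLFormula (Option A) P) (hφ : φ.ProgramsIn (DCFL (Option A))) (p : List A) (N : ℕ)
    (hN : N ≤ p.length) :
    ∃ z, ∀ u, p ++ z <+: u → ∀ k ≤ N,
      (φ.Sat (LTS.separating.{u, v, w} P u) (state P u k true) ↔
        φ.Sat (LTS.separating.{u, v, w} P u) (state P u k false)) := by
  induction φ generalizing p N with
  | fls => exact ⟨[], fun _ _ _ _ => Iff.rfl⟩
  | tru => exact ⟨[], fun _ _ _ _ => Iff.rfl⟩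
  | prop q => exact ⟨[], fun _ _ _ _ => Iff.rfl⟩
  | negProp q => exact ⟨[], fun _ _ _ _ => Iff.rfl⟩
  | or φ ψ ihφ ihψ =>
    obtain ⟨z, hz⟩ := ihφ hφ.1 p N hN
    obtain ⟨z', hz'⟩ := ihψ hφ.2 (p ++ z) N (by rw [List.length_append]; omega)
    rw [List.append_assoc] at hz'
    refine ⟨z ++ z', fun u hu k hk => or_congr (hz u ?_ k hk) (hz' u hu k hk)⟩
    rw [← List.append_assoc] at hu
    exact (List.prefix_append _ _).trans hu
  | and φ ψ ihφ ihψ =>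
    obtain ⟨z, hz⟩ := ihφ hφ.1 p N hN
    obtain ⟨z', hz'⟩ := ihψ hφ.2 (p ++ z) N (by rw [List.length_append]; omega)
    rw [List.append_assoc] at hz'
    refine ⟨z ++ z', fun u hu k hk => and_congr (hz u ?_ k hk) (hz' u hu k hk)⟩
    rw [← List.append_assoc] at hu
    exact (List.prefix_append _ _).trans hu
  | EF L ψ ih =>
    obtain ⟨z, hz⟩ := exists_forall_hasCollision hφ.1 p (N + 1) (by omega)
    obtain ⟨z', hz'⟩ := ih hφ.2 (p ++ z) _ le_rfl
    rw [List.append_assoc] at hz'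
    refine ⟨z ++ z', fun u hu k hk => ?_⟩
    have hS := hz' u hu
    rw [← List.append_assoc] at hu
    have hk' : k ≤ (p ++ z).length := by rw [List.length_append]; omega
    constructor
    · rintro ⟨y, hy, t, ht, hs⟩
      obtain ⟨y', hy', t', ht', h⟩ := exists_path_of_hasCollision
        ((List.prefix_append _ _).trans hu) hS hk' (hz k (by omega)) hy ht
      exact ⟨y', hy', t', ht', h.1 hs⟩
    · rintro ⟨y, hy, t, ht, hs⟩
      obtain ⟨y', hy', t', ht', h⟩ := exists_path_of_path_false (hS k hk') hy ht
      exact ⟨y', hy', t', ht', h.1 hs⟩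
  | AG L ψ ih =>
    obtain ⟨z, hz⟩ := exists_forall_hasCollision hφ.1 p (N + 1) (by omega)
    obtain ⟨z', hz'⟩ := ih hφ.2 (p ++ z) _ le_rfl
    rw [List.append_assoc] at hz'
    refine ⟨z ++ z', fun u hu k hk => ?_⟩
    have hS := hz' u hu
    rw [← List.append_assoc] at hu
    have hk' : k ≤ (p ++ z).length := by rw [List.length_append]; omega
    constructor
    · intro hall y hy t ht
      obtain ⟨y', hy', t', ht', h⟩ := exists_path_of_path_false (hS k hk') hy ht
      exact h.2 (hall y' hy' t' ht')
    · intro hall y hy t ht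
      obtain ⟨y', hy', t', ht', h⟩ := exists_path_of_hasCollision
        ((List.prefix_append _ _).trans hu) hS hk' (hz k (by omega)) hy ht
      exact h.2 (hall y' hy' t' ht')

/-! ### The separation -/

theorem PDLFormula.ProgramsIn.mono {A : Type u} {P : Type v} {C D : Set (Language A)}
    (hCD : C ⊆ D) {φ : PDLFormula A P} (h : φ.ProgramsIn C) : φ.ProgramsIn D := by
  induction φ with
  | fls | tru | prop | negProp => trivial
  | or φ ψ ihφ ihψ | and φ ψ ihφ ihψ => exact ⟨ihφ h.1, ihψ h.2⟩
  | EF L φ ih | AG L φ ih => exact ⟨hCD h.1, ih h.2⟩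

theorem palFormula_mem_PDLplain_CFL (A : Type u) [Finite A] (P : Type v) :
    palFormula A P ∈ PDLplain (CFL (Option A)) P :=
  ⟨⟨palindromeGrammar A, language_palindromeGrammar A⟩, trivial⟩

theorem not_equivalent_palFormula {A : Type u} [Nontrivial A] {P : Type v}
    {φ : PDLFormula (Option A) P} (hφ : φ ∈ PDLplain (DCFL (Option A)) P) :
    ¬ PDLFormula.Equivalent.{u, v, w} φ (palFormula A P) := by
  intro h
  obtain ⟨u, hu⟩ := φ.exists_forall_sat_iff hφ [] 0 le_rfl
  have key := hu u (List.prefix_refl _) 0 le_rfl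
  rw [h, h] at key
  exact LTS.separating.not_sat_palFormula (key.1 LTS.separating.sat_palFormula)

theorem mainTheorem1 (A : Type u) [Finite A] [Nontrivial A] (P : Type v) :
    StrictlyLessExpressive.{u, v, w}
        (PDLplain (DCFL (Option A)) P) (PDLplain (CFL (Option A)) P) ∧
      palFormula A P ∈ PDLplain (CFL (Option A)) P ∧
      ¬ ∃ φ ∈ PDLplain (DCFL (Option A)) P,
          PDLFormula.Equivalent.{u, v, w} φ (palFormula A P) := by
  have hmem := palFormula_mem_PDLplain_CFL A P
  refine ⟨⟨fun φ hφ => ⟨φ, .mono (DCFL_subset_CFL (Option A)) hφ, fun _ _ => Iff.rfl⟩,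
    fun h => ?_⟩, hmem, ?_⟩
  · obtain ⟨φ, hφ, h⟩ := h _ hmem
    exact not_equivalent_palFormula hφ fun T s => (h T s).symm
  · rintro ⟨φ, hφ, h⟩
    exact not_equivalent_palFormula hφ h
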